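/- A p-algebra is a bounded distributive lattice with a unary operation $*$ such that $x\wedge y=0$ iff $x\le y^*$. For $m\ge 0$ let $\bar{\mathbf B}_m$ be the p-algebra obtained from the Boolean algebra with $m$ atoms by adding a new top element, and let $\mathsf{Pa}_m=\mathbf{HSP}(\bar{\mathbf B}_m)$ be the variety it generates. For a p-algebra $\mathbf A$ let $\mathbf Q(\mathbf A)$ be the smallest quasivariety of p-algebras containing $\mathbf A$. For a finite poset $P$ let $\varepsilon(P)$ be the p-algebra of upsets of $P$ ordered by inclusion, where $U^*$ is the largest upset disjoint from $U$; for $x\in P$ let $M(x)$ be the set of maximal elements of $P$ above $x$; and let $P^\sharp=\{M(x):x\in P\}$, ordered by reverse inclusion ($A\le B$ iff $B\subseteq A$). **Lemma 2.4.** Let $m\ge 1$ and let $P$ be a finite poset. If $\mathsf{Pa}_m\subsetneq\mathbf Q(\varepsilon(P))$, then $$\mathsf{Pa}_m\subsetneq\mathbf Q(\varepsilon(P^\sharp))\subseteq\mathbf Q(\varepsilon(P)).$$ In particular, if $\mathbf Q(\varepsilon(P))$ is a cover of $\mathsf{Pa}_m$ in the lattice of quasivarieties of p-algebras (that is, $\mathsf{Pa}_m\subsetneq\mathbf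 Q(\varepsilon(P))$ and no quasivariety lies strictly between them), then $\mathbf Q(\varepsilon(P))=\mathbf Q(\varepsilon(P^\sharp))$. -/

import Mathlib

universe u v

/-- A p-algebra: a bounded distributive lattice with a pseudocomplementation `ᶜ`
(written `*` in the literature). -/
class PAlgebra (α : Type u) extends DistribLattice α, BoundedOrder α, Compl α where
  inf_eq_bot_iff_le_compl : ∀ x y : α, x ⊓ y = ⊥ ↔ x ≤ yᶜ

/-- Homomorphisms of p-algebras. -/
structure PAlgHom (α : Type u) (β : Type v) [PAlgebra α] [PAlgebra β]
    extends BoundedLatticeHom α β where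
  map_compl' : ∀ a : α, toFun aᶜ = (toFun a)ᶜ

/-- A bundled p-algebra. -/
structure PAlg where
  carrier : Type u
  [str : PAlgebra carrier]

namespace PAlg

instance : CoeSort PAlg.{u} (Type u) := ⟨PAlg.carrier⟩

instance (A : PAlg.{u}) : PAlgebra A := A.str

/-! ### Products, and the class operators H, S, P (all closed under isomorphism) -/

instance piPAlgebra {I : Type v} (A : I → Type u) [∀ i, PAlgebra (A i)] :
    PAlgebra (∀ i, A i) where
  toDistribLattice := inferInstance
  toBoundedOrder := inferInstance
  toCompl := ⟨fun f i => (f i)ᶜ⟩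
  inf_eq_bot_iff_le_compl f g := by
    simp only [funext_iff, Pi.le_def]
    exact forall_congr' fun i => PAlgebra.inf_eq_bot_iff_le_compl (f i) (g i)

/-- Homomorphic images of members of `K`. -/
def opH (K : Set PAlg.{u}) : Set PAlg.{u} :=
  {B | ∃ A ∈ K, ∃ f : PAlgHom A B, Function.Surjective f.toFun}

/-- Algebras isomorphic to subalgebras of members of `K`. -/
def opS (K : Set PAlg.{u}) : Set PAlg.{u} :=
  {B | ∃ A ∈ K, ∃ f : PAlgHom B A, Function.Injective f.toFun}

/-- Algebras isomorphic to direct products of (possibly empty) families of members of `K`. -/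
def opP (K : Set PAlg.{u}) : Set PAlg.{u} :=
  {B | ∃ (I : Type u) (A : I → PAlg.{u}), (∀ i, A i ∈ K) ∧
    ∃ f : PAlgHom B (∀ i, A i), Function.Bijective f.toFun}

/-! ### Quasi-identities and quasivarieties -/

/-- Terms in the language of p-algebras. -/
inductive PTerm : Type
  | var : ℕ → PTerm
  | bot : PTerm
  | top : PTerm
  | inf : PTerm → PTerm → PTerm
  | sup : PTerm → PTerm → PTerm
  | compl : PTerm → PTerm

/-- The value of a term under an assignment of the variables. -/
def PTerm.eval {α : Type u} [PAlgebra α] (v : ℕ → α) : PTerm → α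
  | .var n => v n
  | .bot => ⊥
  | .top => ⊤
  | .inf s t => s.eval v ⊓ t.eval v
  | .sup s t => s.eval v ⊔ t.eval v
  | .compl t => (t.eval v)ᶜ

/-- A quasi-identity `s₁ ≈ t₁ ∧ ⋯ ∧ sₙ ≈ tₙ → s ≈ t` (with `n = 0` allowed). -/
structure QuasiIdentity where
  premises : List (PTerm × PTerm)
  lhs : PTerm
  rhs : PTerm

/-- `A` satisfies the quasi-identity `q`. -/
def Satisfies (A : PAlg.{u}) (q : QuasiIdentity) : Prop :=
  ∀ v : ℕ → A, (∀ e ∈ q.premises, e.1.eval v = e.2.eval v) → q.lhs.eval v = q.rhs.eval v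

/-- A quasivariety of p-algebras: the class of all models of a set of quasi-identities. -/
def IsQuasivariety (K : Set PAlg.{u}) : Prop :=
  ∃ E : Set QuasiIdentity, K = {A | ∀ q ∈ E, A.Satisfies q}

/-- `Q A`: the smallest quasivariety containing `A`. -/
def Q (A : PAlg.{u}) : Set PAlg.{u} :=
  ⋂₀ {K | IsQuasivariety K ∧ A ∈ K}

/-- For quasivarieties `K` and `L`: `L` covers `K` in the lattice of quasivarieties
of p-algebras. -/
def IsCover (K L : Set PAlg.{u}) : Prop :=
  K ⊂ L ∧ ∀ N : Set PAlg.{u}, IsQuasivariety N → ¬ (K ⊂ N ∧ N ⊂ L)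

/-! ### The algebras generating the varieties `Pa m` -/

/-- The Boolean algebra with `k` atoms together with a new top element. -/
def BBar (k : ℕ) : Type u := WithTop (Set (ULift.{u} (Fin k)))

namespace BBar

instance (k : ℕ) : DistribLattice (BBar.{u} k) :=
  inferInstanceAs (DistribLattice (WithTop (Set (ULift.{u} (Fin k)))))

instance (k : ℕ) : BoundedOrder (BBar.{u} k) :=
  inferInstanceAs (BoundedOrder (WithTop (Set (ULift.{u} (Fin k)))))

open Classical in
/-- The pseudocomplement: the new top goes to `⊥`, the element `⊥` to the new top, and any other
element to its Boolean complement. -/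
noncomputable def star {k : ℕ} : WithTop (Set (ULift.{u} (Fin k))) →
    WithTop (Set (ULift.{u} (Fin k)))
  | none => ⊥
  | some s => if s = ∅ then ⊤ else ((sᶜ : Set (ULift.{u} (Fin k))) : WithTop _)

theorem inf_eq_bot_iff {k : ℕ} (x y : WithTop (Set (ULift.{u} (Fin k)))) :
    x ⊓ y = ⊥ ↔ x ≤ star y := by
  induction y using WithTop.recTopCoe with
  | top =>
    change x ⊓ ⊤ = ⊥ ↔ x ≤ ⊥
    simp
  | coe t =>
    change x ⊓ (t : WithTop _) = ⊥ ↔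
      x ≤ if t = ∅ then ⊤ else ((tᶜ : Set (ULift.{u} (Fin k))) : WithTop _)
    by_cases ht : t = ∅
    · subst ht
      have h : ((∅ : Set (ULift.{u} (Fin k))) : WithTop (Set (ULift.{u} (Fin k)))) = ⊥ := rfl
      simp [h]
    · rw [if_neg ht]
      induction x using WithTop.recTopCoe with
      | top =>
        have h : (t : WithTop (Set (ULift.{u} (Fin k)))) ≠ ⊥ :=
          fun h => ht (WithTop.coe_injective h)
        simp [h]
      | coe s =>
        rw [← WithTop.coe_inf, ← WithTop.coe_bot, WithTop.coe_inj, WithTop.coe_le_coe,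
          ← disjoint_iff, Set.subset_compl_iff_disjoint_right]

noncomputable instance (k : ℕ) : PAlgebra (BBar.{u} k) where
  toCompl := ⟨star⟩
  inf_eq_bot_iff_le_compl := inf_eq_bot_iff

end BBar

/-- The variety `Pa m = HSP(BBar m)`. -/
def Pa (m : ℕ) : Set PAlg.{u} := opH (opS (opP {PAlg.mk (BBar.{u} m)}))

/-! ### The dual algebra of a poset, and the reduction of a poset -/

/-- Upsets of a poset, ordered by inclusion. -/
def Upset (P : Type u) [PartialOrder P] : Type u := {U : Set P // IsUpperSet U}

namespace Upset

variable {P : Type u} [PartialOrder P]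

instance : DistribLattice (Upset P) where
  le U V := U.1 ⊆ V.1
  le_refl _ := subset_rfl
  le_trans _ _ _ := Set.Subset.trans
  le_antisymm _ _ h h2 := Subtype.ext (Set.Subset.antisymm h h2)
  sup U V := ⟨U.1 ∪ V.1, U.2.union V.2⟩
  inf U V := ⟨U.1 ∩ V.1, U.2.inter V.2⟩
  le_sup_left _ _ := Set.subset_union_left
  le_sup_right _ _ := Set.subset_union_right
  sup_le _ _ _ := Set.union_subset
  inf_le_left _ _ := Set.inter_subset_left
  inf_le_right _ _ := Set.inter_subset_right
  le_inf _ _ _ := Set.subset_inter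
  le_sup_inf U V W := (Set.union_inter_distrib_left U.1 V.1 W.1).ge

instance : BoundedOrder (Upset P) where
  top := ⟨Set.univ, isUpperSet_univ⟩
  le_top _ := Set.subset_univ _
  bot := ⟨∅, isUpperSet_empty⟩
  bot_le _ := Set.empty_subset _

/-- The pseudocomplement of `U` is the largest upset disjoint from `U`. -/
instance : PAlgebra (Upset P) where
  toCompl := ⟨fun U => ⟨{x | ∀ y, x ≤ y → y ∉ U.1}, fun _ _ hxy hx z hz => hx z (hxy.trans hz)⟩⟩
  inf_eq_bot_iff_le_compl U V := by
    constructor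
    · intro h x hx y hxy hy
      have hmem : y ∈ (U ⊓ V).1 := ⟨U.2 hxy hx, hy⟩
      rw [h] at hmem
      exact hmem
    · intro h
      refine Subtype.ext (Set.eq_empty_iff_forall_notMem.mpr ?_)
      rintro x ⟨hxU, hxV⟩
      exact h hxU x le_rfl hxV

end Upset

/-- The dual p-algebra `ε(P)` of a poset `P`: the algebra of its upsets. -/
def dualAlg (P : Type u) [PartialOrder P] : PAlg.{u} := PAlg.mk (Upset P)

/-- `maxAbove x` is the set `M(x)` of maximal elements above `x`. -/
def maxAbove {P : Type u} [PartialOrder P] (x : P) : Set P := {y | x ≤ y ∧ IsMax y}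

/-- The reduction `P♯ = {M(x) : x ∈ P}` of a poset. -/
def Sharp (P : Type u) [PartialOrder P] : Type u := {A : Set P // ∃ x : P, A = maxAbove x}

/-- The reduction is ordered by reverse inclusion. -/
instance (P : Type u) [PartialOrder P] : PartialOrder (Sharp P) where
  le A B := B.1 ⊆ A.1
  le_refl _ := subset_rfl
  le_trans _ _ _ h h2 := Set.Subset.trans h2 h
  le_antisymm _ _ h h2 := Subtype.ext (Set.Subset.antisymm h2 h)

end PAlg

/-!
For `m ≥ 1` the variety `Pa m` is axiomatized by one quasi-identity, Lee's condition: the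
pseudocomplements of `m + 1` pairwise disjoint elements join to `⊤`. Indeed, it says that each prime
ideal lies above at most `m` minimal prime ideals, so that the prime ideals give enough
homomorphisms into `BBar m` to separate points.

The map `x ↦ M(x)` embeds `ε(P♯)` into `ε(P)`, and the image contains all pseudocomplements of
`ε(P)`. Lee's condition only involves pseudocomplements, so if it fails in `ε(P)`, then it fails in
`ε(P♯)`. It remains to find `BBar m` in `Q(ε(P♯))`. For `m ≥ 2` every element of `BBar m` is a join
of two pseudocomplements, so all homomorphisms from `BBar m` to `ε(P)` factor through `ε(P♯)`. For
`m = 1` a failure of Lee's condition gives a dense element other than `⊤`, which together with `⊥`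
and `⊤` forms a copy of the chain `BBar 1`.
-/

namespace PAlgHom

variable {α : Type u} {β : Type v} [PAlgebra α] [PAlgebra β]

instance : FunLike (PAlgHom α β) α β where
  coe f := f.toFun
  coe_injective := by
    rintro ⟨f, _⟩ ⟨g, _⟩ h
    congr
    exact DFunLike.coe_injective h

instance : BoundedLatticeHomClass (PAlgHom α β) α β where
  map_sup f := f.map_sup'
  map_inf f := f.map_inf'
  map_top f := f.map_top'
  map_bot f := f.map_bot'

theorem map_compl (f : PAlgHom α β) (a : α) : f aᶜ = (f a)ᶜ := f.map_compl' a

/-- The identity homomorphism. -/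
def id (α : Type u) [PAlgebra α] : PAlgHom α α where
  toBoundedLatticeHom := BoundedLatticeHom.id α
  map_compl' _ := rfl

/-- The homomorphism into a direct product with prescribed components. -/
def pi {I : Type*} {A : I → Type*} [∀ i, PAlgebra (A i)] (f : ∀ i, PAlgHom α (A i)) :
    PAlgHom α (∀ i, A i) where
  toFun a i := f i a
  map_sup' a b := funext fun i => map_sup (f i) a b
  map_inf' a b := funext fun i => map_inf (f i) a b
  map_top' := funext fun i => map_top (f i)
  map_bot' := funext fun i => map_bot (f i)
  map_compl' a := funext fun i => (f i).map_compl a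

theorem exists_comp_eq_of_range_subset {γ : Type*} [PAlgebra γ] (j : PAlgHom α β)
    (hj : Function.Injective j) (f : PAlgHom γ β) (hf : Set.range f ⊆ Set.range j) :
    ∃ g : PAlgHom γ α, ⇑j ∘ g = f := by
  choose g hg using fun c => hf ⟨c, rfl⟩
  exact ⟨{
    toFun := g
    map_sup' := fun a b => hj (by rw [map_sup, hg, hg, hg, map_sup])
    map_inf' := fun a b => hj (by rw [map_inf, hg, hg, hg, map_inf])
    map_top' := hj (by rw [hg, map_top, map_top])
    map_bot' := hj (by rw [hg, map_bot, map_bot])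
    map_compl' := fun a => hj (by rw [map_compl, hg, hg, map_compl]) }, funext hg⟩

end PAlgHom

namespace PAlgebra

open Function Order

section Compl

variable {α : Type u} [PAlgebra α] {x y : α}

theorem le_compl_iff_disjoint : x ≤ yᶜ ↔ Disjoint x y := by
  rw [disjoint_iff, inf_eq_bot_iff_le_compl]

theorem disjoint_compl_left (x : α) : Disjoint xᶜ x := le_compl_iff_disjoint.1 le_rfl

theorem compl_anti : Antitone (compl : α → α) := fun _ y h =>
  le_compl_iff_disjoint.2 ((disjoint_compl_left y).mono_right h)

theorem le_compl_compl (x : α) : x ≤ xᶜᶜ := le_compl_iff_disjoint.2 (disjoint_compl_left x).symm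

theorem compl_compl_compl (x : α) : xᶜᶜᶜ = xᶜ :=
  (compl_anti (le_compl_compl x)).antisymm (le_compl_compl xᶜ)

theorem compl_bot : (⊥ : α)ᶜ = ⊤ := top_le_iff.1 (le_compl_iff_disjoint.2 disjoint_bot_right)

theorem compl_top : (⊤ : α)ᶜ = ⊥ := disjoint_top.1 (disjoint_compl_left ⊤)

theorem disjoint_compl_compl_left_iff : Disjoint xᶜᶜ y ↔ Disjoint x y := by
  rw [disjoint_comm, ← le_compl_iff_disjoint, compl_compl_compl, le_compl_iff_disjoint,
    disjoint_comm]

theorem compl_compl_inf (x y : α) : (x ⊓ y)ᶜᶜ = xᶜᶜ ⊓ yᶜᶜ := by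
  refine (le_inf (compl_anti (compl_anti inf_le_left))
    (compl_anti (compl_anti inf_le_right))).antisymm ?_
  rw [le_compl_iff_disjoint, disjoint_assoc, disjoint_compl_compl_left_iff, disjoint_left_comm,
    disjoint_compl_compl_left_iff, disjoint_left_comm, ← disjoint_assoc]
  exact (disjoint_compl_left _).symm

theorem compl_sup_compl_compl (x : α) : (x ⊔ xᶜ)ᶜ = ⊥ :=
  disjoint_self.1 (Disjoint.mono_right (compl_anti le_sup_left)
    ((disjoint_compl_left _).mono_right le_sup_right))

end Compl

section Orthogonalize

variable {α : Type u} {β : Type v} [PAlgebra α] [PAlgebra β] {ι : Type*} [Fintype ι] [DecidableEq ι]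

/-- The family obtained from `c` by cutting each member down to the part that is disjoint from all
the others; it turns families that are disjoint only modulo a filter or a congruence into disjoint
ones. -/
def orthogonalize (c : ι → α) (i : ι) : α :=
  c i ⊓ (Finset.univ.erase i).inf fun j => (c j)ᶜ

theorem pairwise_disjoint_orthogonalize (c : ι → α) : Pairwise (Disjoint on orthogonalize c) :=
  fun _ j hij => (disjoint_compl_left (c j)).mono
    (inf_le_right.trans (Finset.inf_le (Finset.mem_erase.2 ⟨hij.symm, Finset.mem_univ j⟩)))
    inf_le_left

theorem orthogonalize_eq_self {c : ι → α} (hc : Pairwise (Disjoint on c)) : orthogonalize c = c :=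
  funext fun _ => inf_eq_left.2 <| Finset.le_inf fun _ hj =>
    le_compl_iff_disjoint.2 (hc (Finset.ne_of_mem_erase hj).symm)

theorem map_orthogonalize (f : PAlgHom α β) (c : ι → α) :
    f ∘ orthogonalize c = orthogonalize (f ∘ c) := by
  funext i
  simp only [orthogonalize, comp_apply, map_inf, map_finset_inf, comp_def, PAlgHom.map_compl]

end Orthogonalize

/-- Lee's condition: if `x₀, …, xₘ` are pairwise disjoint, then `x₀ᶜ ⊔ ⋯ ⊔ xₘᶜ = ⊤`. The join is
expressed through an arbitrary upper bound `z`, which makes the condition a quasi-identity. For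
`m ≥ 1` it axiomatizes the variety `Pa m`. -/
def LeeCondition (m : ℕ) (α : Type u) [PAlgebra α] : Prop :=
  ∀ (x : Fin (m + 1) → α) (z : α), Pairwise (Disjoint on x) → (∀ i, (x i)ᶜ ≤ z) → z = ⊤

namespace LeeCondition

variable {m : ℕ} {α : Type u} {β : Type v} [PAlgebra α] [PAlgebra β]

theorem sup_compl_eq_top (h : LeeCondition m α) {x : Fin (m + 1) → α}
    (hx : Pairwise (Disjoint on x)) : Finset.univ.sup (fun i => (x i)ᶜ) = ⊤ :=
  h x _ hx fun i => Finset.le_sup (f := fun i => (x i)ᶜ) (Finset.mem_univ i)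

theorem of_injective (h : LeeCondition m β) (f : PAlgHom α β) (hf : Injective f) :
    LeeCondition m α := fun x z hx hz => hf <| by
  rw [map_top]
  refine h (f ∘ x) (f z) (fun i j hij => (hx hij).map f) fun i => ?_
  rw [comp_apply, ← f.map_compl]
  exact OrderHomClass.mono f (hz i)

theorem pi {I : Type*} {A : I → Type*} [∀ i, PAlgebra (A i)] (h : ∀ i, LeeCondition m (A i)) :
    LeeCondition m (∀ i, A i) := fun x z hx hz =>
  funext fun k => h k (fun i => x i k) (z k) (fun _ _ hij => Pi.disjoint_iff.1 (hx hij) k)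
    fun i => hz i k

/-- Orthogonalizing lifts a disjoint family along a surjective homomorphism to a disjoint one. -/
theorem of_surjective (h : LeeCondition m α) (f : PAlgHom α β) (hf : Surjective f) :
    LeeCondition m β := by
  intro x z hx hz
  obtain ⟨c, rfl⟩ := hf.comp_left x
  have hfc : ∀ i, f (orthogonalize c i) = f (c i) :=
    congrFun ((map_orthogonalize f c).trans (orthogonalize_eq_self hx))
  rw [← top_le_iff, ← map_top f,
    ← h.sup_compl_eq_top (pairwise_disjoint_orthogonalize c), map_finset_sup]
  refine Finset.sup_le fun i _ => ?_
  rw [comp_apply, f.map_compl, hfc]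
  exact hz i

theorem of_compl_mem_range (h : LeeCondition m α) (j : PAlgHom α β) (hj : Injective j)
    (hc : ∀ b, bᶜ ∈ Set.range j) : LeeCondition m β := by
  intro x z hx hz
  choose y hy using fun i => hc (x i)ᶜ
  have hy_disj : Pairwise (Disjoint on y) := fun i k hik => by
    have hjy : Disjoint (j (y i)) (j (y k)) := by
      rw [hy, hy, disjoint_compl_compl_left_iff, disjoint_comm, disjoint_compl_compl_left_iff]
      exact (hx hik).symm
    exact disjoint_iff.2 (hj (by rw [map_inf, map_bot, hjy.eq_bot]))
  rw [← top_le_iff, ← map_top j, ← h.sup_compl_eq_top hy_disj, map_finset_sup]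
  refine Finset.sup_le fun i _ => ?_
  rw [comp_apply, j.map_compl, hy, compl_compl_compl]
  exact hz i

end LeeCondition

theorem exists_range_eq_of_forall_not_injective {β : Type*} {S : Set β} (hS : S.Nonempty) {m : ℕ}
    (h : ∀ f : Fin (m + 1) → β, (∀ i, f i ∈ S) → ¬ Injective f) :
    ∃ g : Fin m → β, Set.range g = S := by
  rcases Embedding.total (Fin m) S with ⟨⟨f⟩⟩ | ⟨⟨f⟩⟩
  · refine ⟨fun i => f i, (Set.range_subset_iff.2 fun i => (f i).2).antisymm fun b hb => ?_⟩
    by_contra hbf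
    refine h (Fin.cons b fun i => f i) (Fin.cases hb fun i => (f i).2) ?_
    exact Fin.cons_injective_iff.2 ⟨hbf, Subtype.val_injective.comp f.injective⟩
  · have : Nonempty S := hS.to_subtype
    refine ⟨Subtype.val ∘ invFun f, ?_⟩
    rw [(invFun_surjective f.injective).range_comp, Subtype.range_val]

section PrimeIdeals

variable {α : Type u} [PAlgebra α] {I J : Ideal α}

theorem inf_mem_iff_of_isPrime (hI : I.IsPrime) {x y : α} : x ⊓ y ∈ I ↔ x ∈ I ∨ y ∈ I :=
  ⟨hI.mem_or_mem, fun h => h.elim (I.lower inf_le_left) (I.lower inf_le_right)⟩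

theorem mem_or_compl_mem (hI : I.IsPrime) (x : α) : x ∈ I ∨ xᶜ ∈ I :=
  hI.mem_or_mem (by rw [(disjoint_compl_left x).symm.eq_bot]; exact I.bot_mem)

theorem finset_inf_notMem_of_isPrime (hI : I.IsPrime) {ι : Type*} {s : Finset ι} {f : ι → α}
    (h : ∀ i ∈ s, f i ∉ I) : s.inf f ∉ I :=
  Finset.inf_induction (p := (· ∉ I)) (Ideal.isProper_iff_top_notMem.1 hI.toIsProper)
    (fun _ ha _ hb hab => (hI.mem_or_mem hab).elim ha hb) h

/-- The elements dense modulo the filter generated by `a` and the complement of `I`. -/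
def denseFilter (hI : I.IsPrime) (a : α) : PFilter α :=
  IsPFilter.toPFilter (F := {y | ∃ f ∉ I, f ⊓ a ≤ yᶜᶜ}) <| by
    have top_notMem := Ideal.isProper_iff_top_notMem.1 hI.toIsProper
    refine .of_def ⟨⊤, ⊤, top_notMem, by simp [compl_top, compl_bot]⟩ ?_ ?_
    · rintro y ⟨f, hf, hfy⟩ z ⟨g, hg, hgz⟩
      refine ⟨y ⊓ z, ⟨f ⊓ g, fun h => (hI.mem_or_mem h).elim hf hg, ?_⟩, inf_le_left, inf_le_right⟩
      rw [compl_compl_inf]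
      exact le_inf ((inf_le_inf_right a inf_le_left).trans hfy)
        ((inf_le_inf_right a inf_le_right).trans hgz)
    · rintro y z hyz ⟨f, hf, hfy⟩
      exact ⟨f, hf, hfy.trans (compl_anti (compl_anti hyz))⟩

/-- A prime ideal avoiding all dense elements `x ⊔ xᶜ` contains `x` or `xᶜ` but never both. -/
theorem exists_isPrime_le_forall_compl_notMem (hI : I.IsPrime) {a : α} (ha : aᶜ ∈ I) :
    ∃ J ≤ I, J.IsPrime ∧ a ∉ J ∧ ∀ x ∈ J, xᶜ ∉ J := by
  have top_notMem := Ideal.isProper_iff_top_notMem.1 hI.toIsProper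
  have disj : Disjoint (denseFilter hI a : Set α) (Ideal.principal (⊥ : α)) := by
    rw [Set.disjoint_left]
    intro y ⟨f, hf, hfa⟩ hy
    obtain rfl := le_bot_iff.1 (Ideal.mem_principal.1 hy)
    change f ⊓ a ≤ ⊥ᶜᶜ at hfa
    rw [compl_bot, compl_top, le_bot_iff, ← disjoint_iff, ← le_compl_iff_disjoint] at hfa
    exact hf (I.lower hfa ha)
  obtain ⟨J, hJ, -, hdJ⟩ := DistribLattice.prime_ideal_of_disjoint_filter_ideal disj
  have notMem_J {x f : α} (hf : f ∉ I) (h : f ⊓ a ≤ xᶜᶜ) : x ∉ J :=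
    Set.disjoint_left.1 hdJ ⟨f, hf, h⟩
  refine ⟨J, fun x hx => ?_, hJ, notMem_J top_notMem (inf_le_right.trans (le_compl_compl a)),
    fun x hx hxc => notMem_J top_notMem ?_ (Ideal.sup_mem hx hxc)⟩
  · by_contra hxI
    exact notMem_J hxI (inf_le_left.trans (le_compl_compl x)) hx
  · rw [compl_sup_compl_compl, compl_bot]
    exact le_top

theorem minimal_isPrime_iff :
    Minimal Order.Ideal.IsPrime J ↔ J.IsPrime ∧ ∀ x ∈ J, xᶜ ∉ J := by
  refine ⟨fun hJ => ⟨hJ.prop, fun x hx hxc => ?_⟩, fun ⟨hJ, hc⟩ => ⟨hJ, fun K hK hKJ x hx => ?_⟩⟩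
  · obtain ⟨K, hKJ, hK, hxK, -⟩ := exists_isPrime_le_forall_compl_notMem hJ.prop hxc
    exact hxK (hJ.le_of_le hK hKJ hx)
  · exact (mem_or_compl_mem hK x).resolve_right fun h => hc x hx (hKJ h)

theorem compl_mem_iff_notMem (hJ : Minimal Order.Ideal.IsPrime J) {x : α} : xᶜ ∈ J ↔ x ∉ J :=
  ⟨fun hxc hx => (minimal_isPrime_iff.1 hJ).2 x hx hxc, (mem_or_compl_mem hJ.prop x).resolve_left⟩

theorem compl_mem_iff_exists_minimal_isPrime (hI : I.IsPrime) {x : α} :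
    xᶜ ∈ I ↔ ∃ J, (Minimal Order.Ideal.IsPrime J ∧ J ≤ I) ∧ x ∉ J := by
  refine ⟨fun hx => ?_, fun ⟨J, ⟨hJ, hJI⟩, hxJ⟩ => hJI ((compl_mem_iff_notMem hJ).2 hxJ)⟩
  obtain ⟨J, hJI, hJ, hxJ, hc⟩ := exists_isPrime_le_forall_compl_notMem hI hx
  exact ⟨J, ⟨minimal_isPrime_iff.2 ⟨hJ, hc⟩, hJI⟩, hxJ⟩

theorem exists_notMem_forall_ne_mem {ι : Type*} [Finite ι] {J : ι → Ideal α}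
    (hJ : ∀ i, Minimal Order.Ideal.IsPrime (J i)) (hinj : Injective J) (i : ι) :
    ∃ c, c ∉ J i ∧ ∀ j ≠ i, c ∈ J j := by
  classical
  have := Fintype.ofFinite ι
  have hsep (j : ι) : ∃ a, j ≠ i → a ∈ J j ∧ a ∉ J i := by
    by_cases hji : j = i
    · exact ⟨⊥, fun h => (h hji).elim⟩
    · obtain ⟨a, ha⟩ := SetLike.not_le_iff_exists.1 fun hle =>
        hji (hinj ((hJ i).eq_of_le (hJ j).prop hle))
      exact ⟨a, fun _ => ha⟩
  choose a ha using hsep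
  refine ⟨(Finset.univ.erase i).inf a, finset_inf_notMem_of_isPrime (hJ i).prop fun j hj =>
    (ha j (Finset.ne_of_mem_erase hj)).2, fun j hj => (J j).lower (Finset.inf_le ?_) (ha j hj).1⟩
  exact Finset.mem_erase.2 ⟨hj, Finset.mem_univ j⟩

theorem LeeCondition.not_injective {m : ℕ} (h : LeeCondition m α) (hI : I.IsPrime)
    {J : Fin (m + 1) → Ideal α} (hJ : ∀ i, Minimal Order.Ideal.IsPrime (J i)) (hJI : ∀ i, J i ≤ I) :
    ¬ Injective J := by
  intro hinj
  choose c hci hcj using exists_notMem_forall_ne_mem hJ hinj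
  have hmem (i : Fin (m + 1)) : orthogonalize c i ∉ J i := fun hi =>
    ((hJ i).prop.mem_or_mem hi).elim (hci i) <|
      finset_inf_notMem_of_isPrime (hJ i).prop fun j hj hcompl =>
        (compl_mem_iff_notMem (hJ i)).1 hcompl (hcj j i (Finset.ne_of_mem_erase hj).symm)
  refine Ideal.isProper_iff_top_notMem.1 hI.toIsProper ?_
  rw [← h.sup_compl_eq_top (pairwise_disjoint_orthogonalize c), Ideal.finsetSup_mem_iff]
  exact fun i _ => hJI i ((compl_mem_iff_notMem (hJ i)).2 (hmem i))

theorem LeeCondition.exists_range_eq_minimal_isPrime {m : ℕ} (h : LeeCondition m α)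
    (hI : I.IsPrime) :
    ∃ J : Fin m → Ideal α, Set.range J = {J | Minimal Order.Ideal.IsPrime J ∧ J ≤ I} := by
  refine exists_range_eq_of_forall_not_injective ?_ fun K hK =>
    h.not_injective hI (fun i => (hK i).1) fun i => (hK i).2
  have htop : (⊤ : α)ᶜ ∈ I := by rw [compl_top]; exact I.bot_mem
  obtain ⟨J, hJ, -⟩ := (compl_mem_iff_exists_minimal_isPrime hI).1 htop
  exact ⟨J, hJ⟩

end PrimeIdeals

end PAlgebra

namespace PAlg

open Function PAlgebra Order

namespace BBar

variable {k m : ℕ}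

/-- A set of atoms, regarded as an element of `BBar k` below the new top. -/
def ofSet (s : Set (ULift.{u} (Fin k))) : BBar.{u} k := WithTop.some s

theorem ofSet_empty : ofSet (∅ : Set (ULift.{u} (Fin k))) = ⊥ := rfl

theorem ofSet_injective : Injective (ofSet : _ → BBar.{u} k) := WithTop.coe_injective

theorem ofSet_ne_top (s : Set (ULift.{u} (Fin k))) : ofSet s ≠ ⊤ := WithTop.coe_ne_top

theorem ofSet_le_ofSet {s t : Set (ULift.{u} (Fin k))} : ofSet s ≤ ofSet t ↔ s ⊆ t :=
  WithTop.coe_le_coe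

theorem ofSet_inf (s t : Set (ULift.{u} (Fin k))) : ofSet s ⊓ ofSet t = ofSet (s ∩ t) := rfl

theorem ofSet_sup (s t : Set (ULift.{u} (Fin k))) : ofSet s ⊔ ofSet t = ofSet (s ∪ t) := rfl

theorem compl_ofSet {s : Set (ULift.{u} (Fin k))} (hs : s.Nonempty) : (ofSet s)ᶜ = ofSet sᶜ :=
  if_neg hs.ne_empty

theorem eq_top_or_eq_ofSet (x : BBar.{u} k) : x = ⊤ ∨ ∃ s, x = ofSet s := by
  cases x using WithTop.recTopCoe with
  | top => exact Or.inl rfl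
  | coe s => exact Or.inr ⟨s, rfl⟩

theorem exists_ofSet_singleton_le (hk : 1 ≤ k) {x : BBar.{u} k} (hx : x ≠ ⊥) :
    ∃ t, ofSet {t} ≤ x := by
  rcases eq_top_or_eq_ofSet x with rfl | ⟨s, rfl⟩
  · exact ⟨⟨0, hk⟩, le_top⟩
  · have hs : s ≠ ∅ := fun h => hx (by rw [h, ofSet_empty])
    obtain ⟨t, ht⟩ := Set.nonempty_iff_ne_empty.2 hs
    exact ⟨t, ofSet_le_ofSet.2 (Set.singleton_subset_iff.2 ht)⟩

theorem leeCondition (hm : 1 ≤ m) : LeeCondition m (BBar.{u} m) := by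
  intro x z hx hz
  by_cases hbot : ∃ i, x i = ⊥
  · obtain ⟨i, hi⟩ := hbot
    simpa only [hi, PAlgebra.compl_bot, top_le_iff] using hz i
  · simp only [not_exists] at hbot
    choose t ht using fun i => exists_ofSet_singleton_le hm (hbot i)
    obtain ⟨i, j, hij, htij⟩ := Fintype.exists_ne_map_eq_of_card_lt t (by simp)
    have hle : ofSet {t i} ≤ (⊥ : BBar.{u} m) := hx hij (ht i) (htij ▸ ht j)
    exact (ofSet_le_ofSet.1 hle rfl).elim

theorem exists_eq_compl_sup_compl (hk : 2 ≤ k) (c : BBar.{u} k) : ∃ a b, c = aᶜ ⊔ bᶜ := by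
  rcases eq_top_or_eq_ofSet c with rfl | ⟨s, rfl⟩
  · exact ⟨⊥, ⊥, by rw [PAlgebra.compl_bot, sup_idem]⟩
  · have : Nontrivial (Fin k) := Fin.nontrivial_iff_two_le.2 hk
    obtain ⟨i, j, hij⟩ := exists_pair_ne (ULift.{u} (Fin k))
    refine ⟨ofSet (s \ {i})ᶜ, ofSet (s \ {j})ᶜ, ?_⟩
    rw [compl_ofSet ⟨i, fun h => h.2 rfl⟩, compl_ofSet ⟨j, fun h => h.2 rfl⟩, compl_compl,
      compl_compl, ofSet_sup, ← Set.sdiff_inter,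
      Set.singleton_inter_eq_empty.2 (show i ∉ {j} from hij), Set.sdiff_empty]

instance : Finite (BBar.{u} k) := inferInstanceAs (Finite (Option (Set (ULift.{u} (Fin k)))))

end BBar

section HomOfPrime

variable {α : Type v} [PAlgebra α] {m : ℕ}

theorem compl_mem_iff_nonempty_setOf_notMem {I : Ideal α} (hI : I.IsPrime) {J : Fin m → Ideal α}
    (hJ : Set.range J = {J | Minimal Order.Ideal.IsPrime J ∧ J ≤ I}) {x : α} :
    xᶜ ∈ I ↔ {i : ULift.{u} (Fin m) | x ∉ J i.down}.Nonempty := by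
  rw [compl_mem_iff_exists_minimal_isPrime hI]
  change (∃ K ∈ {J | Minimal Order.Ideal.IsPrime J ∧ J ≤ I}, x ∉ K) ↔ _
  rw [← hJ, Set.exists_range_iff]
  exact (ULift.exists (p := fun i : ULift (Fin m) => x ∉ J i.down)).symm

open Classical in
/-- The map into `BBar m` determined by a prime ideal `I` and a list `J` of the minimal prime ideals
below it: outside `I` it is `⊤`, and on `I` it records which `J i` are avoided. -/
noncomputable def primeMap (I : Ideal α) (J : Fin m → Ideal α) (x : α) : BBar.{u} m :=
  if x ∈ I then BBar.ofSet {i | x ∉ J i.down} else ⊤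

theorem primeMap_of_mem {I : Ideal α} {J : Fin m → Ideal α} {x : α} (hx : x ∈ I) :
    primeMap I J x = BBar.ofSet {i | x ∉ J i.down} := if_pos hx

theorem primeMap_of_notMem {I : Ideal α} {J : Fin m → Ideal α} {x : α} (hx : x ∉ I) :
    primeMap I J x = ⊤ := if_neg hx

theorem primeMap_compl {I : Ideal α} (hI : I.IsPrime) {J : Fin m → Ideal α}
    (hJ : Set.range J = {J | Minimal Order.Ideal.IsPrime J ∧ J ≤ I}) (x : α) :
    primeMap.{u} I J xᶜ = (primeMap I J x)ᶜ := by
  have hset : {i : ULift.{u} (Fin m) | xᶜ ∉ J i.down} = {i | x ∉ J i.down}ᶜ :=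
    Set.ext fun i => not_congr (compl_mem_iff_notMem (hJ.le ⟨i.down, rfl⟩).1)
  rcases Set.eq_empty_or_nonempty {i : ULift.{u} (Fin m) | x ∉ J i.down} with hs | hs
  · have hxc : xᶜ ∉ I := fun h => ((compl_mem_iff_nonempty_setOf_notMem hI hJ).1 h).ne_empty hs
    rw [primeMap_of_notMem hxc, primeMap_of_mem ((mem_or_compl_mem hI x).resolve_right hxc), hs,
      BBar.ofSet_empty, PAlgebra.compl_bot]
  · rw [primeMap_of_mem ((compl_mem_iff_nonempty_setOf_notMem hI hJ).2 hs), hset]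
    by_cases hx : x ∈ I
    · rw [primeMap_of_mem hx, BBar.compl_ofSet hs]
    · have huniv : {i : ULift.{u} (Fin m) | x ∉ J i.down} = Set.univ :=
        Set.eq_univ_of_forall fun i hi => hx ((hJ.le ⟨i.down, rfl⟩).2 hi)
      rw [primeMap_of_notMem hx, PAlgebra.compl_top, huniv, Set.compl_univ, BBar.ofSet_empty]

/-- `primeMap I J` as a homomorphism. -/
noncomputable def homOfPrime {I : Ideal α} (hI : I.IsPrime) {J : Fin m → Ideal α}
    (hJ : Set.range J = {J | Minimal Order.Ideal.IsPrime J ∧ J ≤ I}) :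
    PAlgHom α (BBar.{u} m) where
  toFun := primeMap I J
  map_sup' x y := by
    by_cases hx : x ∈ I <;> by_cases hy : y ∈ I <;>
      simp only [primeMap, hx, hy, Ideal.sup_mem_iff, and_true, and_false, if_true, if_false,
        top_sup_eq, sup_top_eq, not_and_or, BBar.ofSet_sup]
    rfl
  map_inf' x y := by
    have hJ_inf (i) := inf_mem_iff_of_isPrime (hJ.le ⟨i, rfl⟩).1.prop (x := x) (y := y)
    have hJ_notMem (i) {z : α} (hz : z ∉ I) : z ∉ J i := fun h => hz ((hJ.le ⟨i, rfl⟩).2 h)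
    by_cases hx : x ∈ I <;> by_cases hy : y ∈ I <;>
      simp only [primeMap, hx, hy, inf_mem_iff_of_isPrime hI, hJ_inf, hJ_notMem, or_self, or_true,
        or_false, false_or, not_or, not_false_eq_true, if_true, if_false, BBar.ofSet_inf,
        inf_top_eq, top_inf_eq]
    rfl
  map_top' := primeMap_of_notMem (Ideal.isProper_iff_top_notMem.1 hI.toIsProper)
  map_bot' := by
    simp only [primeMap_of_mem I.bot_mem, Ideal.bot_mem, not_true_eq_false, Set.ofPred_false,
      BBar.ofSet_empty]
  map_compl' := primeMap_compl hI hJ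

theorem exists_hom_ne (hα : LeeCondition m α) {a b : α} (hab : a ≠ b) :
    ∃ f : PAlgHom α (BBar.{u} m), f a ≠ f b := by
  wlog hle : ¬ a ≤ b generalizing a b
  · obtain ⟨f, hf⟩ := this hab.symm fun h => hab ((not_not.1 hle).antisymm h)
    exact ⟨f, hf.symm⟩
  have hdisj : Disjoint (PFilter.principal a : Set α) (Ideal.principal b) :=
    Set.disjoint_left.2 fun x hax hxb =>
      hle ((PFilter.mem_principal.1 hax).trans (Ideal.mem_principal.1 hxb))
  obtain ⟨I, hI, hbI, haI⟩ := DistribLattice.prime_ideal_of_disjoint_filter_ideal hdisj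
  have ha : a ∉ I := Set.disjoint_left.1 haI (PFilter.mem_principal.2 le_rfl)
  have hb : b ∈ I := hbI (Ideal.mem_principal.2 le_rfl)
  obtain ⟨J, hJ⟩ := hα.exists_range_eq_minimal_isPrime hI
  refine ⟨homOfPrime hI hJ, ?_⟩
  change primeMap I J a ≠ primeMap I J b
  rw [primeMap_of_notMem ha, primeMap_of_mem hb]
  exact (BBar.ofSet_ne_top _).symm

end HomOfPrime

theorem leeCondition_of_mem_Pa {m : ℕ} (hm : 1 ≤ m) {A : PAlg.{u}} (hA : A ∈ Pa.{u} m) :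
    LeeCondition m A := by
  obtain ⟨B, ⟨C, ⟨I, D, hD, f, hf⟩, g, hg⟩, h, hh⟩ := hA
  have hD' (i : I) : LeeCondition m (D i) := by
    rw [Set.mem_singleton_iff.1 (hD i)]
    exact BBar.leeCondition hm
  exact (((LeeCondition.pi hD').of_injective f hf.injective).of_injective g hg).of_surjective h hh

theorem mem_Pa_of_leeCondition {m : ℕ} {A : PAlg.{u}} (hA : LeeCondition m A) : A ∈ Pa.{u} m := by
  refine ⟨A, ⟨PAlg.mk (PAlgHom A (BBar.{u} m) → BBar.{u} m), ⟨PAlgHom A (BBar.{u} m),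
    fun _ => PAlg.mk (BBar.{u} m), fun _ => rfl, PAlgHom.id _, bijective_id⟩,
    PAlgHom.pi fun f => f, fun a b hab => ?_⟩, PAlgHom.id A, surjective_id⟩
  by_contra hne
  obtain ⟨f, hf⟩ := exists_hom_ne hA hne
  exact hf (congrFun hab f)

section Quasivarieties

variable {A B : PAlg.{u}}

theorem mem_Q_iff : B ∈ Q A ↔ ∀ q, A.Satisfies q → B.Satisfies q := by
  constructor
  · intro h
    exact h _ ⟨⟨{q | A.Satisfies q}, rfl⟩, fun _ hq => hq⟩
  · rintro h _ ⟨⟨E, rfl⟩, hA⟩ q hq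
    exact h q (hA q hq)

theorem isQuasivariety_Q (A : PAlg.{u}) : IsQuasivariety (Q A) :=
  ⟨{q | A.Satisfies q}, Set.ext fun _ => mem_Q_iff⟩

theorem self_mem_Q (A : PAlg.{u}) : A ∈ Q A := mem_Q_iff.2 fun _ h => h

theorem Q_subset_Q (h : B ∈ Q A) : Q B ⊆ Q A := fun _ hC =>
  mem_Q_iff.2 fun q hq => mem_Q_iff.1 hC q (mem_Q_iff.1 h q hq)

theorem PTerm.map_eval {α : Type u} {β : Type v} [PAlgebra α] [PAlgebra β]
    (f : PAlgHom α β) (v : ℕ → α) (t : PTerm) : f (t.eval v) = t.eval (f ∘ v) := by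
  induction t with
  | var n => rfl
  | bot => exact map_bot f
  | top => exact map_top f
  | inf s t hs ht => rw [PTerm.eval, map_inf, hs, ht, PTerm.eval]
  | sup s t hs ht => rw [PTerm.eval, map_sup, hs, ht, PTerm.eval]
  | compl t ht => rw [PTerm.eval, f.map_compl, ht, PTerm.eval]

theorem mem_Q_of_exists_hom_ne (h : ∀ a b : B, a ≠ b → ∃ f : PAlgHom B A, f a ≠ f b) :
    B ∈ Q A := by
  refine mem_Q_iff.2 fun q hq v hv => ?_
  by_contra hne
  obtain ⟨f, hf⟩ := h _ _ hne
  refine hf ?_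
  rw [PTerm.map_eval, PTerm.map_eval]
  refine hq _ fun e he => ?_
  rw [← PTerm.map_eval, ← PTerm.map_eval, hv e he]

theorem mem_Q_of_injective (f : PAlgHom B A) (hf : Injective f) : B ∈ Q A :=
  mem_Q_of_exists_hom_ne fun _ _ hab => ⟨f, hf.ne hab⟩

/-- `LeeCondition m` as a quasi-identity: the variable `0` stands for the bound `z` and the variable
`i + 1` for `xᵢ`. -/
noncomputable def leeQuasiIdentity (m : ℕ) : QuasiIdentity where
  premises :=
    ((Finset.univ : Finset (Fin (m + 1))).offDiag.toList.map fun p =>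
      (.inf (.var (p.1 + 1)) (.var (p.2 + 1)), .bot)) ++
    (List.finRange (m + 1)).map fun i => (.sup (.compl (.var (i + 1))) (.var 0), .var 0)
  lhs := .var 0
  rhs := .top

theorem satisfies_leeQuasiIdentity_iff {m : ℕ} :
    A.Satisfies (leeQuasiIdentity m) ↔ LeeCondition m A := by
  have premises_iff (v : ℕ → A) :
      (∀ e ∈ (leeQuasiIdentity m).premises, e.1.eval v = e.2.eval v) ↔
        Pairwise (Disjoint on fun i : Fin (m + 1) => v (i + 1)) ∧
          ∀ i : Fin (m + 1), (v (i + 1))ᶜ ≤ v 0 := by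
    simp only [leeQuasiIdentity, List.forall_mem_append, List.forall_mem_map, Finset.mem_toList,
      Finset.mem_offDiag, Finset.mem_univ, true_and, List.mem_finRange, forall_const, PTerm.eval,
      Prod.forall, Pairwise, onFun, disjoint_iff, sup_eq_right, ne_eq]
  refine ⟨fun h x z hx hz => ?_, fun h v hv => ?_⟩
  · let v : ℕ → A := fun | 0 => z | n + 1 => x (Fin.ofNat (m + 1) n)
    have hv (i : Fin (m + 1)) : v (i + 1) = x i := congrArg x (Fin.cast_val_eq_self i)
    refine h v ((premises_iff v).2 ?_)
    simp only [hv]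
    exact ⟨hx, hz⟩
  · obtain ⟨hx, hz⟩ := (premises_iff v).1 hv
    exact h _ _ hx hz

theorem Q_subset_Pa {m : ℕ} (hA : LeeCondition m A) : Q A ⊆ Pa.{u} m := fun _ hB =>
  mem_Pa_of_leeCondition <| satisfies_leeQuasiIdentity_iff.1 <|
    mem_Q_iff.1 hB _ (satisfies_leeQuasiIdentity_iff.2 hA)

theorem Pa_subset_Q {m : ℕ} (hm : 1 ≤ m) (hA : PAlg.mk (BBar.{u} m) ∈ Q A) : Pa.{u} m ⊆ Q A :=
  fun _ hB => Q_subset_Q hA <| mem_Q_of_exists_hom_ne fun _ _ hab =>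
    exists_hom_ne (leeCondition_of_mem_Pa hm hB) hab

end Quasivarieties

section Diagram

variable {α : Type u} {β : Type v} [PAlgebra α] [PAlgebra β] {e : β → ℕ}

/-- The equations describing the operation tables of `β`, where the variable `e b` denotes `b`. -/
def diagram (e : β → ℕ) : Set (PTerm × PTerm) :=
  {(.var (e ⊥), .bot), (.var (e ⊤), .top)} ∪
    Set.range (fun a : β => (.var (e aᶜ), .compl (.var (e a)))) ∪
    Set.range (fun p : β × β => (.var (e (p.1 ⊓ p.2)), .inf (.var (e p.1)) (.var (e p.2)))) ∪
    Set.range (fun p : β × β => (.var (e (p.1 ⊔ p.2)), .sup (.var (e p.1)) (.var (e p.2))))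

theorem forall_mem_diagram_iff {v : ℕ → α} :
    (∀ p ∈ diagram e, p.1.eval v = p.2.eval v) ↔ ∃ f : PAlgHom β α, f = v ∘ e := by
  simp only [diagram, Set.mem_union, Set.mem_insert_iff, Set.mem_singleton_iff, or_imp, forall_and,
    forall_eq, Set.forall_mem_range, PTerm.eval, Prod.forall]
  constructor
  · rintro ⟨⟨⟨⟨hbot, htop⟩, hcompl⟩, hinf⟩, hsup⟩
    exact ⟨{ toFun := v ∘ e, map_sup' := hsup, map_inf' := hinf, map_top' := htop,
             map_bot' := hbot, map_compl' := hcompl }, rfl⟩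
  · rintro ⟨f, hf⟩
    have hv (b : β) : v (e b) = f b := (congrFun hf b).symm
    simp only [hv, map_bot, map_top, map_inf, map_sup, f.map_compl, implies_true, and_self]

theorem exists_hom_ne_of_mem_Q {A B : PAlg.{u}} [Finite B] (h : B ∈ Q A) {a b : B} (hab : a ≠ b) :
    ∃ f : PAlgHom B A, f a ≠ f b := by
  obtain ⟨e, he⟩ := exists_injective_nat B
  have hfin : (diagram e).Finite := by unfold diagram; exact Set.toFinite _
  let q : QuasiIdentity := ⟨hfin.toFinset.toList, .var (e a), .var (e b)⟩
  have hq {C : PAlg.{u}} : C.Satisfies q ↔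
      ∀ v : ℕ → C, (∃ f : PAlgHom B C, f = v ∘ e) → v (e a) = v (e b) := by
    simp [Satisfies, q, ← forall_mem_diagram_iff, PTerm.eval]
  by_contra! hcon
  have hA : A.Satisfies q := hq.2 fun v ⟨f, hf⟩ => by
    simpa only [hf] using! hcon f
  have hB := hq.1 (mem_Q_iff.1 h q hA) (invFun e) ⟨PAlgHom.id B, (invFun_comp he).symm⟩
  rw [leftInverse_invFun he, leftInverse_invFun he] at hB
  exact hab hB

end Diagram

section Chain

variable {α : Type u} [PAlgebra α]

namespace BBar

theorem eq_bot_or_eq_ofSet_univ_or_eq_top (x : BBar.{v} 1) :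
    x = ⊥ ∨ x = ofSet Set.univ ∨ x = ⊤ := by
  rcases eq_top_or_eq_ofSet x with rfl | ⟨s, rfl⟩
  · exact Or.inr (Or.inr rfl)
  · rcases s.eq_empty_or_nonempty with rfl | hs
    · exact Or.inl ofSet_empty
    · exact Or.inr (Or.inl (by rw [Subsingleton.eq_univ_of_nonempty hs]))

open Classical in
/-- The map from the three-element chain `BBar 1` that sends its middle element to `d`. -/
noncomputable def chainMap (d : α) (x : BBar.{v} 1) : α :=
  if x = ⊤ then ⊤ else if x = ⊥ then ⊥ else d

variable {d : α}

theorem chainMap_top : chainMap d ⊤ = ⊤ := if_pos rfl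

theorem chainMap_bot : chainMap d ⊥ = ⊥ := (if_neg (ofSet_ne_top ∅)).trans (if_pos rfl)

theorem chainMap_univ : chainMap d (ofSet Set.univ) = d :=
  (if_neg (ofSet_ne_top _)).trans (if_neg (ofSet_injective.ne Set.univ_nonempty.ne_empty))

theorem chainMap_injective (hd : d ≠ ⊤) (hdc : dᶜ = ⊥) : Injective (chainMap d) := by
  have hd_bot : d ≠ ⊥ := by
    rintro rfl
    exact hd (hdc.symm.trans PAlgebra.compl_bot)
  have hbot : (⊥ : α) ≠ ⊤ := fun h => hd (top_le_iff.1 (h ▸ bot_le))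
  intro x y hxy
  rcases x.eq_bot_or_eq_ofSet_univ_or_eq_top with rfl | rfl | rfl <;>
    rcases y.eq_bot_or_eq_ofSet_univ_or_eq_top with rfl | rfl | rfl <;>
    simp_all [chainMap_bot, chainMap_univ, chainMap_top, eq_comm]

/-- `chainMap d` as a homomorphism, for a dense element `d`. -/
noncomputable def chainHom (hd : dᶜ = ⊥) : PAlgHom (BBar.{v} 1) α where
  toFun := chainMap d
  map_sup' x y := by
    rcases x.eq_bot_or_eq_ofSet_univ_or_eq_top with rfl | rfl | rfl <;>
      rcases y.eq_bot_or_eq_ofSet_univ_or_eq_top with rfl | rfl | rfl <;>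
      simp [chainMap_bot, chainMap_univ, chainMap_top]
  map_inf' x y := by
    rcases x.eq_bot_or_eq_ofSet_univ_or_eq_top with rfl | rfl | rfl <;>
      rcases y.eq_bot_or_eq_ofSet_univ_or_eq_top with rfl | rfl | rfl <;>
      simp [chainMap_bot, chainMap_univ, chainMap_top]
  map_top' := chainMap_top
  map_bot' := chainMap_bot
  map_compl' x := by
    rcases x.eq_bot_or_eq_ofSet_univ_or_eq_top with rfl | rfl | rfl
    · rw [PAlgebra.compl_bot, chainMap_bot, chainMap_top, PAlgebra.compl_bot]
    · rw [compl_ofSet Set.univ_nonempty, Set.compl_univ, ofSet_empty, chainMap_bot, chainMap_univ,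
        hd]
    · rw [PAlgebra.compl_top, chainMap_bot, chainMap_top, PAlgebra.compl_top]

end BBar

theorem exists_ne_top_compl_eq_bot (h : ¬ LeeCondition 1 α) : ∃ d : α, d ≠ ⊤ ∧ dᶜ = ⊥ := by
  simp only [LeeCondition, not_forall] at h
  obtain ⟨x, z, hx, hz, hne⟩ := h
  refine ⟨z, hne, disjoint_self.1 ?_⟩
  have hx_le : x 1 ≤ z := (le_compl_iff_disjoint.2 (hx (by decide))).trans (hz 0)
  exact (PAlgebra.disjoint_compl_left z).mono_right ((compl_anti hx_le).trans (hz 1))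

end Chain

theorem BBar_mem_Q_of_compl_mem_range {A B : PAlg.{u}} (j : PAlgHom A B) (hj : Injective j)
    (hc : ∀ b, bᶜ ∈ Set.range j) {m : ℕ} (hm : 2 ≤ m) (h : PAlg.mk (BBar.{u} m) ∈ Q B) :
    PAlg.mk (BBar.{u} m) ∈ Q A := by
  have : Finite (PAlg.mk (BBar.{u} m)) := inferInstanceAs (Finite (BBar.{u} m))
  refine mem_Q_of_exists_hom_ne fun a b hab => ?_
  obtain ⟨f, hf⟩ := exists_hom_ne_of_mem_Q h hab
  have hrange : Set.range f ⊆ Set.range j := by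
    rintro _ ⟨c, rfl⟩
    obtain ⟨x, y, rfl⟩ := BBar.exists_eq_compl_sup_compl hm c
    obtain ⟨p, hp⟩ := hc (f x)
    obtain ⟨q, hq⟩ := hc (f y)
    refine ⟨p ⊔ q, ?_⟩
    rw [map_sup, hp, hq, ← f.map_compl, ← f.map_compl]
    exact (map_sup f _ _).symm
  obtain ⟨g, hg⟩ := j.exists_comp_eq_of_range_subset hj f hrange
  refine ⟨g, fun hgab => hf ?_⟩
  rw [← hg, comp_apply, comp_apply, hgab]

theorem Pa_ssubset_Q_of_compl_mem_range {A B : PAlg.{u}} (j : PAlgHom A B) (hj : Injective j)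
    (hc : ∀ b, bᶜ ∈ Set.range j) {m : ℕ} (hm : 1 ≤ m) (h : Pa.{u} m ⊂ Q B) : Pa.{u} m ⊂ Q A := by
  have hA : ¬ LeeCondition m A := fun hA =>
    h.not_subset (Q_subset_Pa (hA.of_compl_mem_range j hj hc))
  refine ⟨Pa_subset_Q hm ?_, fun hsub => hA (leeCondition_of_mem_Pa hm (hsub (self_mem_Q A)))⟩
  rcases hm.eq_or_lt with rfl | hm2
  · obtain ⟨d, hd, hdc⟩ := exists_ne_top_compl_eq_bot hA
    exact mem_Q_of_injective (BBar.chainHom hdc) (BBar.chainMap_injective hd hdc)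
  · exact BBar_mem_Q_of_compl_mem_range j hj hc hm2
      (h.subset (mem_Pa_of_leeCondition (BBar.leeCondition hm)))

section Sharp

variable {P : Type u} {R : Type v} [PartialOrder P] [PartialOrder R]

/-- The preimage homomorphism of a monotone map `f` such that every element above `f x` lies below
some `f y` with `x ≤ y`. -/
def Upset.comap (f : P →o R) (hf : ∀ x r, f x ≤ r → ∃ y, x ≤ y ∧ r ≤ f y) :
    PAlgHom (Upset R) (Upset P) where
  toFun U := ⟨f ⁻¹' U.1, U.2.preimage f.monotone⟩
  map_sup' _ _ := rfl
  map_inf' _ _ := rfl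
  map_top' := rfl
  map_bot' := rfl
  map_compl' U := by
    refine Subtype.ext (Set.ext fun x => ⟨fun h y hxy => h _ (f.monotone hxy), ?_⟩)
    intro h r hr hrU
    obtain ⟨y, hxy, hry⟩ := hf x r hr
    exact h y hxy (U.2 hry hrU)

theorem Upset.comap_injective {f : P →o R} (hf : ∀ x r, f x ≤ r → ∃ y, x ≤ y ∧ r ≤ f y)
    (hsurj : Surjective f) : Injective (Upset.comap f hf) := fun _ _ h =>
  Subtype.ext (hsurj.preimage_injective (congrArg Subtype.val h))

theorem maxAbove_nonempty [Finite P] (x : P) : (maxAbove x).Nonempty := by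
  obtain ⟨y, hxy, hy⟩ := Finite.exists_le_maximal (p := fun _ : P => True) (a := x) trivial
  exact ⟨y, hxy, maximal_true.1 hy⟩

theorem maxAbove_anti : Antitone (maxAbove : P → Set P) :=
  fun _ _ h _ hz => ⟨h.trans hz.1, hz.2⟩

/-- The canonical map `x ↦ M(x)` of a poset onto its reduction. -/
def toSharp : P →o Sharp P where
  toFun x := ⟨maxAbove x, x, rfl⟩
  monotone' _ _ h := maxAbove_anti h

theorem toSharp_surjective : Surjective (toSharp : P →o Sharp P) := by
  rintro ⟨_, x, rfl⟩
  exact ⟨x, rfl⟩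

theorem exists_le_toSharp (hP : ∀ x : P, (maxAbove x).Nonempty) (x : P) (A : Sharp P)
    (h : toSharp x ≤ A) : ∃ y, x ≤ y ∧ A ≤ toSharp y := by
  obtain ⟨z, rfl⟩ := toSharp_surjective A
  obtain ⟨y, hy⟩ := hP z
  exact ⟨y, (h hy).1, toSharp.monotone hy.1⟩

/-- The embedding of `ε(P♯)` into `ε(P)`, for a poset `P` whose elements lie below maximal ones. -/
def sharpHom (hP : ∀ x : P, (maxAbove x).Nonempty) : PAlgHom (Upset (Sharp P)) (Upset P) :=
  Upset.comap toSharp (exists_le_toSharp hP)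

theorem sharpHom_injective (hP : ∀ x : P, (maxAbove x).Nonempty) : Injective (sharpHom hP) :=
  Upset.comap_injective _ toSharp_surjective

theorem compl_mem_range_sharpHom (hP : ∀ x : P, (maxAbove x).Nonempty) (U : Upset P) :
    Uᶜ ∈ Set.range (sharpHom hP) := by
  refine ⟨⟨{A | Disjoint A.1 U.1}, fun _ _ hAB hA => hA.mono_left hAB⟩,
    Subtype.ext (Set.ext fun x => ?_)⟩
  change Disjoint (maxAbove x) U.1 ↔ ∀ y, x ≤ y → y ∉ U.1
  rw [Set.disjoint_left]
  refine ⟨fun h y hxy hy => ?_, fun h y hy => h y hy.1⟩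
  obtain ⟨z, hz⟩ := hP y
  exact h (maxAbove_anti hxy hz) (U.2 hz.1 hy)

end Sharp

end PAlg

theorem lemma2p4_general {P : Type u} [PartialOrder P] (hP : ∀ x : P, (PAlg.maxAbove x).Nonempty)
    (m : ℕ) (hm : 1 ≤ m) :
    (PAlg.Pa.{u} m ⊂ PAlg.Q (PAlg.dualAlg P) →
      PAlg.Pa.{u} m ⊂ PAlg.Q (PAlg.dualAlg (PAlg.Sharp P)) ∧
        PAlg.Q (PAlg.dualAlg (PAlg.Sharp P)) ⊆ PAlg.Q (PAlg.dualAlg P)) ∧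
    (PAlg.IsCover (PAlg.Pa.{u} m) (PAlg.Q (PAlg.dualAlg P)) →
      PAlg.Q (PAlg.dualAlg P) = PAlg.Q (PAlg.dualAlg (PAlg.Sharp P))) := by
  let j : PAlgHom (PAlg.dualAlg (PAlg.Sharp P)) (PAlg.dualAlg P) := PAlg.sharpHom hP
  have hj : Function.Injective j := PAlg.sharpHom_injective hP
  have hssub : PAlg.Pa.{u} m ⊂ PAlg.Q (PAlg.dualAlg P) →
      PAlg.Pa.{u} m ⊂ PAlg.Q (PAlg.dualAlg (PAlg.Sharp P)) :=
    PAlg.Pa_ssubset_Q_of_compl_mem_range j hj (PAlg.compl_mem_range_sharpHom hP) hm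
  have hsub : PAlg.Q (PAlg.dualAlg (PAlg.Sharp P)) ⊆ PAlg.Q (PAlg.dualAlg P) :=
    PAlg.Q_subset_Q (PAlg.mem_Q_of_injective j hj)
  refine ⟨fun h => ⟨hssub h, hsub⟩, fun hcover => ?_⟩
  by_contra hne
  exact hcover.2 _ (PAlg.isQuasivariety_Q _) ⟨hssub hcover.1, hsub.ssubset_of_ne (Ne.symm hne)⟩

theorem lemma2p4 {P : Type u} [PartialOrder P] [Finite P] (m : ℕ) (hm : 1 ≤ m) :
    (PAlg.Pa.{u} m ⊂ PAlg.Q (PAlg.dualAlg P) →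
      PAlg.Pa.{u} m ⊂ PAlg.Q (PAlg.dualAlg (PAlg.Sharp P)) ∧
        PAlg.Q (PAlg.dualAlg (PAlg.Sharp P)) ⊆ PAlg.Q (PAlg.dualAlg P)) ∧
    (PAlg.IsCover (PAlg.Pa.{u} m) (PAlg.Q (PAlg.dualAlg P)) →
      PAlg.Q (PAlg.dualAlg P) = PAlg.Q (PAlg.dualAlg (PAlg.Sharp P))) :=
  lemma2p4_general PAlg.maxAbove_nonempty m hm
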